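/- For integers $m,r\ge 1$ and $x\in\mathbb Z/m\mathbb Z$ with least residue $\bar x\in\{0,\dots,m-1\}$ put $|x|=\min\{\bar x,m-\bar x\}$; the Lee norm of $v=(v_1,\dots,v_r)\in(\mathbb Z/m\mathbb Z)^r$ is $\|v\|=\sum_{i=1}^r|v_i|$. Let $e=(1,\dots,1)$, and call $v$ admissible if $\|v\|\le\|v+x e\|$ for all $x\in\mathbb Z/m\mathbb Z$. Define $$h(m,r)=\begin{cases}\frac{mr}{4}&\text{if } m \text{ and } r \text{ are even},\\ \left\lfloor\frac{mr}{4}-\frac12\right\rfloor&\text{if } m \text{ is even, } r \text{ is odd, and } r>m,\\ \left\lfloor\frac{mr}{4}-\frac{r}{4m}\right\rfloor&\text{if } m \text{ is odd and } r>m,\\ \left\lfloor\frac{mr}{4}-\frac12\right\rfloor&\text{if } m \text{ is odd, } r \text{ is even, and } r<m,\\ \left\lfloor\frac{mr}{4}-\frac{m}{4r}\right\rfloor&\text{if } r \text{ is odd and } r\le m.\end{cases}$$ Then for all positive integers $m$ and $r$, the largest Lee norm of an admissible vector in $(\mathbb Z/m\mathbb Z)^r$ equals $h(m,r)$. Moreover,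 if $m>2$, then $h(m,r)$ is the covering radius of the repetition code $(\mathbb Z/m\mathbb Z)e\subseteq(\mathbb Z/m\mathbb Z)^r$ in the Lee metric, that is, the smallest $\rho$ such that every $v\in(\mathbb Z/m\mathbb Z)^r$ satisfies $\|v-c\|\le\rho$ for some $c\in(\mathbb Z/m\mathbb Z)e$. -/

import Mathlib

/-- The absolute least residue `|x| = min (x̄, m - x̄)` of `x : ZMod m`, where `x̄ ∈ {0, …, m - 1}`
is the least residue of `x` (for `m > 0`). -/
def leeAbs {m : ℕ} (x : ZMod m) : ℕ := min x.val (m - x.val)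

/-- The Lee norm of a vector in `(ℤ/mℤ)^r`. -/
def leeNorm {m r : ℕ} (v : Fin r → ZMod m) : ℕ := ∑ i, leeAbs (v i)

/-- The all-one vector `e = (1, …, 1)` of `(ℤ/mℤ)^r`. -/
def allOne (m r : ℕ) : Fin r → ZMod m := fun _ => 1

/-- `v` is admissible (for the Lee norm) if no translate of `v` by a multiple of the all-one
vector has smaller Lee norm. -/
def LeeAdmissible {m r : ℕ} (v : Fin r → ZMod m) : Prop :=
  ∀ x : ZMod m, leeNorm v ≤ leeNorm (v + x • allOne m r)

/-- The norm bound function `h(m, r)` for positive integers `m`, `r`, with values in `ℚ` so that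
all divisions are exact. The last branch is the case that `r` is odd and `r ≤ m`. -/
def hBound (m r : ℕ) : ℚ :=
  if Even m ∧ Even r then (m * r : ℚ) / 4
  else if Even m ∧ Odd r ∧ m < r then (⌊(m * r : ℚ) / 4 - 1 / 2⌋ : ℤ)
  else if Odd m ∧ m < r then (⌊(m * r : ℚ) / 4 - (r : ℚ) / (4 * m)⌋ : ℤ)
  else if Odd m ∧ Even r ∧ r < m then (⌊(m * r : ℚ) / 4 - 1 / 2⌋ : ℤ)
  else (⌊(m * r : ℚ) / 4 - (m : ℚ) / (4 * r)⌋ : ℤ)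

/-- The Lee distance of two vectors in `(ℤ/mℤ)^r`. -/
def leeDistance {m r : ℕ} (a b : Fin r → ZMod m) : ℕ := ∑ i, leeAbs (a i - b i)

/-- `ρ` is the covering radius of the code `C` in the Lee metric: the smallest `ρ` such that every
vector has Lee distance at most `ρ` from at least one codeword. -/
def IsLeeCoveringRadius {m r : ℕ} (C : Set (Fin r → ZMod m)) (ρ : ℚ) : Prop :=
  IsLeast {ρ : ℚ | ∀ v : Fin r → ZMod m, ∃ c ∈ C, (leeDistance v c : ℚ) ≤ ρ} ρ

/-- The repetition code `(ℤ/mℤ) e` in `(ℤ/mℤ)^r`. -/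
def repetitionCode (m r : ℕ) : Submodule (ZMod m) (Fin r → ZMod m) :=
  Submodule.span (ZMod m) {allOne m r}

/-! Write `leeSum v x` for the norm of the translate of `v` by `x • e`. Both claims say that the
largest possible value of `min_x leeSum v x` is `hBound m r`: translating an extremal vector to its
minimiser makes it admissible, and distances to codewords are values of `leeSum`.

Upper bounds on the minimum come from three averages. Averaging over all `x` gives the bounds for
`m` odd and for `m`, `r` both even. If `m` is even and `r` odd, `leeSum v x + leeSum v (x + 1)` is
odd, and averaging these pairs gains 1/2. If `r` is odd, averaging over the translates `x = -v i`
gives the sum of all pairwise distances; that sum is bounded by counting, for every half circle, the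
excess of points inside over points outside, an odd number whose square is at least 1.

For the lower bounds, vectors are concatenated from blocks (`LeeAttains.append`): antipodal pairs
for `m` even, all residues once for `m` odd, chains of nearly antipodal pairs for `m` odd and even
length (`leeAttains_consecutive_windows`), and nearly equally spaced points for odd `r ≤ m`
(`leeAttains_of_odd`). For the last block, concavity of `leeAbs` away from 0 reduces the check to `x
= -v i`. -/

/-! ### Absolute residues on the cycle. -/

theorem ZMod.sum_eq_sum_range {M : Type*} [AddCommMonoid M] {m : ℕ} [NeZero m] (f : ZMod m → M) :
    ∑ x, f x = ∑ k ∈ Finset.range m, f (k : ZMod m) := by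
  refine Finset.sum_nbij' ZMod.val (fun k => (k : ZMod m)) ?_ ?_ ?_ ?_ ?_
  · intro x _
    simpa using ZMod.val_lt x
  · simp
  · simp
  · intro k hk
    simpa using ZMod.val_cast_of_lt (Finset.mem_range.1 hk)
  · simp

theorem leeAbs_natCast {m k : ℕ} [NeZero m] (hk : k ≤ m) :
    leeAbs (k : ZMod m) = min k (m - k) := by
  rcases hk.lt_or_eq with h | rfl
  · rw [leeAbs, ZMod.val_cast_of_lt h]
  · simp [leeAbs]

theorem leeAbs_intCast {m : ℕ} [NeZero m] {a : ℤ} (h0 : 0 ≤ a) (h1 : a ≤ m) :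
    (leeAbs (a : ZMod m) : ℤ) = min a (m - a) := by
  lift a to ℕ using h0
  have h : a ≤ m := by exact_mod_cast h1
  rw [Int.cast_natCast, leeAbs_natCast h]
  push_cast [h]
  rfl

theorem exists_natCast_eq {m : ℕ} [NeZero m] (x : ZMod m) : ∃ k < m, (k : ZMod m) = x :=
  ⟨x.val, ZMod.val_lt x, by simp⟩

theorem leeAbs_neg {m : ℕ} [NeZero m] (x : ZMod m) : leeAbs (-x) = leeAbs x := by
  obtain ⟨k, hk, rfl⟩ := exists_natCast_eq x
  have h : (-(k : ZMod m)) = ((m - k : ℕ) : ZMod m) := by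
    rw [Nat.cast_sub hk.le]; simp
  rw [h, leeAbs_natCast (Nat.sub_le _ _), leeAbs_natCast hk.le]
  omega

theorem leeAbs_zero {m : ℕ} : leeAbs (0 : ZMod m) = 0 := by
  simp [leeAbs]

theorem leeAbs_add_one_add_leeAbs_sub_one_le {m : ℕ} [NeZero m] {x : ZMod m} (hx : x ≠ 0) :
    leeAbs (x + 1) + leeAbs (x - 1) ≤ 2 * leeAbs x := by
  obtain ⟨k, hk, rfl⟩ := exists_natCast_eq x
  have hk0 : k ≠ 0 := by rintro rfl; simp at hx
  have h1 : (k : ZMod m) + 1 = ((k + 1 : ℕ) : ZMod m) := by push_cast; rfl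
  have h2 : (k : ZMod m) - 1 = ((k - 1 : ℕ) : ZMod m) := by
    rw [Nat.cast_sub (by omega)]; simp
  rw [h1, h2, leeAbs_natCast (by omega), leeAbs_natCast (by omega), leeAbs_natCast hk.le]
  omega

theorem odd_leeAbs_add_leeAbs_add_one {m : ℕ} [NeZero m] (hm : Even m) (x : ZMod m) :
    Odd (leeAbs x + leeAbs (x + 1)) := by
  obtain ⟨k, hk, rfl⟩ := exists_natCast_eq x
  have h1 : (k : ZMod m) + 1 = ((k + 1 : ℕ) : ZMod m) := by push_cast; rfl
  rw [h1, leeAbs_natCast hk.le, leeAbs_natCast (by omega)]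
  obtain ⟨n, rfl⟩ := hm
  rw [Nat.odd_iff]
  omega

theorem leeAbs_add_leeAbs_add_half {n : ℕ} [NeZero (2 * n)] (x : ZMod (2 * n)) :
    leeAbs x + leeAbs (x + (n : ZMod (2 * n))) = n := by
  obtain ⟨k, hk, rfl⟩ := exists_natCast_eq x
  rcases le_total k n with h | h
  · have h1 : (k : ZMod (2 * n)) + n = ((k + n : ℕ) : ZMod (2 * n)) := by push_cast; rfl
    rw [h1, leeAbs_natCast hk.le, leeAbs_natCast (by omega)]
    omega
  · have h1 : (k : ZMod (2 * n)) + n = ((k - n : ℕ) : ZMod (2 * n)) := by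
      rw [Nat.cast_sub h, eq_sub_iff_add_eq, add_assoc, ← Nat.cast_add, ← two_mul,
        ZMod.natCast_self, add_zero]
    rw [h1, leeAbs_natCast hk.le, leeAbs_natCast (by omega)]
    omega

/-- No exact antipode exists for odd modulus: a nearly antipodal pair loses 1 exactly when `x` lies
in a window of length `n + 1`. -/
theorem leeAbs_add_leeAbs_add_succ_half {n : ℕ} (x : ZMod (2 * n + 1)) :
    leeAbs x + leeAbs (x + ((n + 1 : ℕ) : ZMod (2 * n + 1))) + (if x.val < n + 1 then 1 else 0)
      = n + 1 := by
  obtain ⟨k, hk, rfl⟩ := exists_natCast_eq x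
  rw [ZMod.val_cast_of_lt hk]
  split_ifs with h
  · rw [← Nat.cast_add, leeAbs_natCast hk.le, leeAbs_natCast (by omega)]
    omega
  · have h1 : (k : ZMod (2 * n + 1)) + (n + 1 : ℕ) = ((k - n : ℕ) : ZMod (2 * n + 1)) := by
      rw [Nat.cast_sub (by omega), eq_sub_iff_add_eq, add_assoc, ← Nat.cast_add,
        show n + 1 + n = 2 * n + 1 by omega, ZMod.natCast_self, add_zero]
    rw [h1, leeAbs_natCast hk.le, leeAbs_natCast (by omega)]
    omega

theorem four_mul_sum_min_sub (m : ℕ) :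
    4 * ∑ k ∈ Finset.range m, min k (m - k) + m % 2 = m ^ 2 := by
  induction m using Nat.twoStepInduction with
  | zero => simp
  | one => simp
  | more m ih _ =>
    have h : ∑ k ∈ Finset.range (m + 2), min k (m + 2 - k)
        = ∑ k ∈ Finset.range m, min k (m - k) + (m + 1) := by
      rw [Finset.sum_range_succ, Finset.sum_range_succ']
      have : ∀ k ∈ Finset.range m, min (k + 1) (m + 2 - (k + 1)) = min k (m - k) + 1 := by
        intro k hk
        have := Finset.mem_range.1 hk
        omega
      rw [Finset.sum_congr rfl this, Finset.sum_add_distrib]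
      simp
      omega
    rw [h]
    have : (m + 2) % 2 = m % 2 := by omega
    rw [this]
    linarith [show (m + 2) ^ 2 = m ^ 2 + 4 * m + 4 by ring]

theorem four_mul_sum_leeAbs (m : ℕ) [NeZero m] :
    4 * ∑ x : ZMod m, leeAbs x + m % 2 = m ^ 2 := by
  rw [← four_mul_sum_min_sub m, ZMod.sum_eq_sum_range]
  congr 2
  exact Finset.sum_congr rfl fun k hk => leeAbs_natCast (Finset.mem_range.1 hk).le

/-! ### Upper bounds by averaging over translates. -/

/-- The Lee norm of the translate of `v` by `x` times the all-one vector. -/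
def leeSum {m r : ℕ} (v : Fin r → ZMod m) (x : ZMod m) : ℕ := ∑ i, leeAbs (v i + x)

theorem leeNorm_add_smul_allOne {m r : ℕ} (v : Fin r → ZMod m) (x : ZMod m) :
    leeNorm (v + x • allOne m r) = leeSum v x := by
  simp [leeNorm, leeSum, allOne]

theorem leeDistance_smul_allOne {m r : ℕ} (v : Fin r → ZMod m) (x : ZMod m) :
    leeDistance v (x • allOne m r) = leeSum v (-x) := by
  simp [leeDistance, leeSum, allOne, sub_eq_add_neg]

theorem four_mul_sum_leeSum {m r : ℕ} [NeZero m] (v : Fin r → ZMod m) :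
    4 * ∑ x, leeSum v x + r * (m % 2) = r * m ^ 2 := by
  have h : ∑ x, leeSum v x = r * ∑ x : ZMod m, leeAbs x := by
    simp only [leeSum]
    rw [Finset.sum_comm]
    have : ∀ i, ∑ x, leeAbs (v i + x) = ∑ x : ZMod m, leeAbs x := fun i =>
      Equiv.sum_comp (Equiv.addLeft (v i)) leeAbs
    simp [this]
  rw [h, ← four_mul_sum_leeAbs m]
  ring

theorem exists_leeSum_le_average {m r : ℕ} [NeZero m] (v : Fin r → ZMod m) :
    ∃ x, 4 * m * leeSum v x + r * (m % 2) ≤ r * m ^ 2 := by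
  obtain ⟨x, -, hx⟩ := Finset.exists_min_image Finset.univ (leeSum v) Finset.univ_nonempty
  refine ⟨x, ?_⟩
  rw [← four_mul_sum_leeSum v]
  have := Finset.card_nsmul_le_sum Finset.univ (leeSum v) (leeSum v x) hx
  simp only [Finset.card_univ, ZMod.card, smul_eq_mul] at this
  linarith

theorem exists_leeSum_le_of_even_of_odd {m r : ℕ} [NeZero m] (hm : Even m) (hr : Odd r)
    (v : Fin r → ZMod m) : ∃ x, 4 * leeSum v x + 2 ≤ m * r := by
  have hodd : ∀ x, Odd (leeSum v x + leeSum v (x + 1)) := by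
    intro x
    simp only [leeSum]
    rw [← Finset.sum_add_distrib, Finset.odd_sum_iff_odd_card_odd]
    have : ∀ i, Odd (leeAbs (v i + x) + leeAbs (v i + (x + 1))) := by
      intro i
      rw [← add_assoc]
      exact odd_leeAbs_add_leeAbs_add_one hm _
    simpa [this] using hr
  have hpos : 0 < m := Nat.pos_of_ne_zero (NeZero.ne m)
  obtain ⟨x, -, hx⟩ := Finset.exists_min_image Finset.univ
    (fun x => leeSum v x + leeSum v (x + 1)) Finset.univ_nonempty
  have h := Finset.card_nsmul_le_sum Finset.univ _ _ hx
  have hshift : ∑ x, leeSum v (x + 1) = ∑ x, leeSum v x :=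
    Equiv.sum_comp (Equiv.addRight (1 : ZMod m)) (leeSum v)
  rw [Finset.sum_add_distrib, hshift] at h
  simp only [Finset.card_univ, ZMod.card, smul_eq_mul] at h
  have h4 := four_mul_sum_leeSum v
  rw [Nat.even_iff.1 hm, mul_zero, add_zero] at h4
  -- The smallest pair sum is at most `m * r / 2`. Being odd, say `2 * c + 1`, it has a summand at
  -- most `c`, which saves the 2 in the statement.
  have h2 : m * (2 * (leeSum v x + leeSum v (x + 1))) ≤ m * (m * r) := by nlinarith
  have h3 := Nat.le_of_mul_le_mul_left h2 hpos
  obtain ⟨c, hc⟩ := hodd x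
  rcases le_total (leeSum v x) (leeSum v (x + 1)) with hle | hle
  · exact ⟨x, by omega⟩
  · exact ⟨x + 1, by omega⟩

/-! ### Upper bound for odd length by half-circle signs. -/

/-- The sign of `z` with respect to the half circle `{0, …, ⌈m/2⌉ - 1}` of `ZMod m`. -/
def halfSign {m : ℕ} (z : ZMod m) : ℤ := if 2 * z.val < m then 1 else -1

theorem halfSign_natCast {m k : ℕ} (hk : k < m) :
    halfSign (k : ZMod m) = if 2 * k < m then 1 else -1 := by
  rw [halfSign, ZMod.val_cast_of_lt hk]

/-- A shift by `k` changes the sign on two disjoint arcs of length `k`, those ending at the two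
boundaries of the half circle; each changed sign costs 2. -/
theorem sum_halfSign_mul_natCast_le {m k : ℕ} [NeZero m] (hk : 2 * k ≤ m) :
    ∑ z : ZMod m, halfSign z * halfSign (z + (k : ZMod m)) ≤ m - 4 * k := by
  have hm : 0 < m := Nat.pos_of_ne_zero (NeZero.ne m)
  set h := (m + 1) / 2 with hh
  have hle : ∀ n ∈ Finset.range m,
      halfSign (n : ZMod m) * halfSign ((n : ZMod m) + (k : ZMod m)) ≤
        1 - 2 * (if n ∈ Finset.Ico (h - k) h then 1 else 0)
          - 2 * (if n ∈ Finset.Ico (m - k) m then (1 : ℤ) else 0) := by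
    intro n hn
    rw [Finset.mem_range] at hn
    simp only [Finset.mem_Ico]
    rw [halfSign_natCast hn]
    rcases lt_or_ge (n + k) m with h1 | h1
    · rw [← Nat.cast_add, halfSign_natCast h1]
      split_ifs <;> omega
    · have : (n : ZMod m) + (k : ZMod m) = ((n + k - m : ℕ) : ZMod m) := by
        rw [Nat.cast_sub h1]; simp
      rw [this, halfSign_natCast (by omega)]
      split_ifs <;> omega
  rw [ZMod.sum_eq_sum_range]
  refine (Finset.sum_le_sum hle).trans ?_
  rw [Finset.sum_sub_distrib, Finset.sum_sub_distrib, ← Finset.mul_sum, ← Finset.mul_sum,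
    Finset.sum_ite_mem, Finset.sum_ite_mem, Finset.inter_eq_right.2, Finset.inter_eq_right.2]
  · simp only [Finset.sum_const, Finset.card_range, Nat.card_Ico, nsmul_eq_mul, mul_one]
    omega
  · intro n hn
    simp only [Finset.mem_Ico, Finset.mem_range] at hn ⊢
    omega
  · intro n hn
    simp only [Finset.mem_Ico, Finset.mem_range] at hn ⊢
    omega

theorem sum_halfSign_mul_le {m : ℕ} [NeZero m] (u : ZMod m) :
    ∑ z : ZMod m, halfSign z * halfSign (z + u) ≤ m - 4 * leeAbs u := by
  obtain ⟨k, hk, rfl⟩ := exists_natCast_eq u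
  rw [leeAbs_natCast hk.le]
  rcases le_total (2 * k) m with h | h
  · rw [min_eq_left (by omega)]
    exact sum_halfSign_mul_natCast_le h
  · rw [min_eq_right (by omega)]
    refine le_trans (le_of_eq ?_) (sum_halfSign_mul_natCast_le (by omega))
    rw [← Equiv.sum_comp (Equiv.addRight (k : ZMod m))
      (fun z : ZMod m => halfSign z * halfSign (z + ((m - k : ℕ) : ZMod m)))]
    refine Finset.sum_congr rfl fun z _ => ?_
    simp [Nat.cast_sub hk.le, mul_comm]

/-- For each rotation `t` the sum of `r` signs is odd, so its square is at least 1. Summing the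
squares over `t` and expanding gives the sign correlations of all pairs, each at most `m - 4 *
leeAbs (v j - v i)`. -/
theorem four_mul_sum_leeAbs_sub_le {m r : ℕ} [NeZero m] (hr : Odd r) (v : Fin r → ZMod m) :
    4 * ∑ i, ∑ j, (leeAbs (v j - v i) : ℤ) ≤ m * (r ^ 2 - 1) := by
  have hsq : ∀ t : ZMod m, 1 ≤ (∑ i, halfSign (v i + t)) ^ 2 := by
    intro t
    have hodd : Odd (∑ i, halfSign (v i + t)) := by
      have : ∀ z : ZMod m, halfSign z = 1 - 2 * (if 2 * z.val < m then 0 else 1) := by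
        intro z
        unfold halfSign
        split_ifs <;> rfl
      simp only [this, Finset.sum_sub_distrib, ← Finset.mul_sum, Finset.sum_const,
        Finset.card_univ, Fintype.card_fin, nsmul_eq_mul, mul_one]
      exact Odd.sub_even (by exact_mod_cast hr) (even_two_mul _)
    have : ∑ i, halfSign (v i + t) ≠ 0 := by
      intro h
      simp [h] at hodd
    have := sq_pos_of_ne_zero this
    omega
  have h1 : (m : ℤ) ≤ ∑ t : ZMod m, (∑ i, halfSign (v i + t)) ^ 2 := by
    have := Finset.card_nsmul_le_sum Finset.univ
      (fun t : ZMod m => (∑ i, halfSign (v i + t)) ^ 2) 1 fun t _ => hsq t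
    simpa using this
  have h2 : ∑ t : ZMod m, (∑ i, halfSign (v i + t)) ^ 2
      = ∑ i, ∑ j, ∑ z : ZMod m, halfSign z * halfSign (z + (v j - v i)) := by
    simp only [sq, Finset.sum_mul_sum]
    rw [Finset.sum_comm]
    refine Finset.sum_congr rfl fun i _ => ?_
    rw [Finset.sum_comm]
    refine Finset.sum_congr rfl fun j _ => ?_
    rw [← Equiv.sum_comp (Equiv.addLeft (v i))
      (fun z : ZMod m => halfSign z * halfSign (z + (v j - v i)))]
    refine Finset.sum_congr rfl fun z _ => ?_
    simp only [Equiv.coe_addLeft]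
    congr 2
    ring
  have h3 : ∑ i, ∑ j, ∑ z : ZMod m, halfSign z * halfSign (z + (v j - v i))
      ≤ ∑ i, ∑ j, ((m : ℤ) - 4 * leeAbs (v j - v i)) :=
    Finset.sum_le_sum fun i _ => Finset.sum_le_sum fun j _ => sum_halfSign_mul_le _
  simp only [Finset.sum_sub_distrib, ← Finset.mul_sum, Finset.sum_const, Finset.card_univ,
    Fintype.card_fin, nsmul_eq_mul] at h3
  rw [h2] at h1
  linarith

theorem exists_leeSum_le_of_odd {m r : ℕ} [NeZero m] (hr : Odd r) (v : Fin r → ZMod m) :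
    ∃ x, (4 * r * leeSum v x : ℤ) ≤ m * (r ^ 2 - 1) := by
  have : NeZero r := ⟨hr.pos.ne'⟩
  obtain ⟨i, -, hi⟩ := Finset.exists_min_image Finset.univ
    (fun i => (leeSum v (-v i) : ℤ)) Finset.univ_nonempty
  refine ⟨-v i, ?_⟩
  have h := Finset.card_nsmul_le_sum Finset.univ _ _ hi
  have h4 := four_mul_sum_leeAbs_sub_le hr v
  simp only [leeSum, ← sub_eq_add_neg, Finset.card_univ, Fintype.card_fin, nsmul_eq_mul,
    Nat.cast_sum] at h ⊢
  linarith

theorem exists_leeSum_le_hBound {m r : ℕ} (hm : 0 < m) (hr : 0 < r) (v : Fin r → ZMod m) :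
    ∃ x, (leeSum v x : ℚ) ≤ hBound m r := by
  have : NeZero m := ⟨hm.ne'⟩
  have key : ∀ (n : ℕ) (q : ℚ), (n : ℚ) ≤ q → (n : ℚ) ≤ (⌊q⌋ : ℤ) := by
    intro n q h
    have : (n : ℤ) ≤ ⌊q⌋ := Int.le_floor.2 (by exact_mod_cast h)
    exact_mod_cast this
  have hmq : (0 : ℚ) < m := by exact_mod_cast hm
  have hrq : (0 : ℚ) < r := by exact_mod_cast hr
  obtain ⟨x, hx⟩ := exists_leeSum_le_average v
  unfold hBound
  split_ifs with h1 h2 h3 h4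
  · refine ⟨x, ?_⟩
    rw [Nat.even_iff.1 h1.1] at hx
    have hx' : (4 * m * leeSum v x : ℚ) ≤ r * m ^ 2 := by exact_mod_cast hx
    rw [le_div_iff₀ (by norm_num)]
    refine le_of_mul_le_mul_left ?_ hmq
    linarith
  · obtain ⟨y, hy⟩ := exists_leeSum_le_of_even_of_odd h2.1 h2.2.1 v
    refine ⟨y, key _ _ ?_⟩
    have : (4 * leeSum v y + 2 : ℚ) ≤ m * r := by exact_mod_cast hy
    linarith
  · refine ⟨x, key _ _ ?_⟩
    rw [Nat.odd_iff.1 h3.1] at hx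
    have hx' : (4 * m * leeSum v x + r : ℚ) ≤ r * m ^ 2 := by
      rw [mul_one] at hx; exact_mod_cast hx
    have : (m * r : ℚ) / 4 - r / (4 * m) = (r * m ^ 2 - r) / (4 * m) := by field_simp
    rw [this, le_div_iff₀ (by positivity)]
    linarith
  · refine ⟨x, key _ _ ?_⟩
    rw [Nat.odd_iff.1 h4.1, mul_one] at hx
    -- Only strictness of the average bound is used: since `m * r` is even, `4 * leeSum v x < m * r`
    -- already leaves a gap of 2.
    have h5 : m * (4 * leeSum v x) < m * (m * r) := by nlinarith
    have h6 := lt_of_mul_lt_mul_left h5 hm.le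
    obtain ⟨s, rfl⟩ := h4.2.1
    have h7 : 4 * leeSum v x + 2 ≤ m * (s + s) := by
      have : m * (s + s) = 2 * (m * s) := by ring
      omega
    have : (4 * leeSum v x + 2 : ℚ) ≤ m * (s + s : ℕ) := by exact_mod_cast h7
    linarith
  · have hodd : Odd r := by
      rw [← Nat.not_even_iff_odd]
      intro he
      rcases Nat.even_or_odd m with h | h
      · exact h1 ⟨h, he⟩
      · refine h4 ⟨h, he, lt_of_le_of_ne (not_lt.1 fun h' => h3 ⟨h, h'⟩) ?_⟩
        rintro rfl
        exact Nat.not_even_iff_odd.2 h he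
    obtain ⟨y, hy⟩ := exists_leeSum_le_of_odd hodd v
    refine ⟨y, key _ _ ?_⟩
    have hy' : (4 * r * leeSum v y : ℚ) ≤ m * (r ^ 2 - 1) := by exact_mod_cast hy
    have : (m * r : ℚ) / 4 - m / (4 * r) = (m * (r ^ 2 - 1)) / (4 * r) := by field_simp
    rw [this, le_div_iff₀ (by positivity)]
    linarith

/-! ### Extremal blocks of antipodal and nearly antipodal pairs. -/

/-- Some vector of length `r` has the property that all its translates by multiples of the all-one
vector have Lee norm at least `B`. -/
def LeeAttains (m r : ℕ) (B : ℤ) : Prop :=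
  ∃ v : Fin r → ZMod m, ∀ x, B ≤ leeSum v x

theorem LeeAttains.append {m r₁ r₂ : ℕ} {B₁ B₂ : ℤ} (h₁ : LeeAttains m r₁ B₁)
    (h₂ : LeeAttains m r₂ B₂) : LeeAttains m (r₁ + r₂) (B₁ + B₂) := by
  obtain ⟨v₁, h₁⟩ := h₁
  obtain ⟨v₂, h₂⟩ := h₂
  refine ⟨Fin.append v₁ v₂, fun x => ?_⟩
  have : leeSum (Fin.append v₁ v₂) x = leeSum v₁ x + leeSum v₂ x := by
    simp [leeSum, Fin.sum_univ_add]
  rw [this, Nat.cast_add]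
  exact add_le_add (h₁ x) (h₂ x)

theorem LeeAttains.mono {m r : ℕ} {B B' : ℤ} (h : LeeAttains m r B) (hB : B' ≤ B) :
    LeeAttains m r B' :=
  h.imp fun _ hv x => hB.trans (hv x)

theorem leeAttains_antipodal_pairs {n : ℕ} (hn : 0 < n) (t : ℕ) :
    LeeAttains (2 * n) (2 * t) (t * n) := by
  have : NeZero (2 * n) := ⟨by omega⟩
  induction t with
  | zero => exact ⟨fun _ => 0, fun x => by simp⟩
  | succ t ih =>
    have h : LeeAttains (2 * n) 2 n := by
      refine ⟨![0, n], fun x => ?_⟩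
      have := leeAbs_add_leeAbs_add_half x
      simp only [leeSum, Fin.sum_univ_two, Matrix.cons_val_zero, Matrix.cons_val_one, zero_add]
      rw [add_comm (n : ZMod (2 * n)) x, this]
    refine (ih.append h).mono ?_
    push_cast
    linarith

theorem leeAttains_univ (n : ℕ) : LeeAttains (2 * n + 1) (2 * n + 1) (n * (n + 1)) := by
  refine ⟨fun i => ((i : ℕ) : ZMod (2 * n + 1)), fun x => ?_⟩
  have h := four_mul_sum_leeAbs (2 * n + 1)
  have h2 : leeSum (fun i : Fin (2 * n + 1) => ((i : ℕ) : ZMod (2 * n + 1))) x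
      = ∑ x : ZMod (2 * n + 1), leeAbs x := by
    rw [← Equiv.sum_comp (Equiv.addRight x), ZMod.sum_eq_sum_range, leeSum,
      Fin.sum_univ_eq_sum_range fun k => leeAbs ((k : ZMod (2 * n + 1)) + x)]
    rfl
  rw [h2]
  have h3 : (2 * n + 1) % 2 = 1 := by omega
  rw [h3] at h
  zify at h
  push_cast
  nlinarith

/-- With `a = i * h + c`, the indicator is `a / m - (a - h) / m`, and `a - h` is the preceding `a`,
so the sum telescopes: the windows are laid end to end around the cycle. -/
theorem sum_window_indicator {m h : ℕ} (hm : 0 < m) (hh : h ≤ m) (c t : ℕ) :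
    ∑ i ∈ Finset.range t, (if (i * h + c) % m < h then (1 : ℤ) else 0)
      = ((t : ℤ) * h + c - h) / m - ((c : ℤ) - h) / m := by
  induction t with
  | zero => simp
  | succ t ih =>
    rw [Finset.sum_range_succ, ih]
    have hstep : (if (t * h + c) % m < h then (1 : ℤ) else 0)
        = ((t : ℤ) * h + c) / m - ((t : ℤ) * h + c - h) / m := by
      generalize ha : t * h + c = a
      have ha' : (t : ℤ) * h + c = a := by exact_mod_cast ha
      rw [ha']
      have h1 := Nat.div_add_mod a m
      have h2 := Nat.mod_lt a hm
      have h3 : (a : ℤ) = m * (a / m : ℕ) + (a % m : ℕ) := by exact_mod_cast h1.symm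
      have hm' : (m : ℤ) ≠ 0 := by positivity
      have e : ∀ b : ℤ, ((m : ℤ) * (a / m : ℕ) + b) / m = (a / m : ℕ) + b / m := by
        intro b
        rw [add_comm, Int.add_mul_ediv_left _ _ hm', add_comm]
      rw [h3, add_sub_assoc ((m : ℤ) * (a / m : ℕ)), e, e, Int.ediv_eq_zero_of_lt (by positivity) (by exact_mod_cast h2)]
      split_ifs with hlt
      · have : (((a % m : ℕ) : ℤ) - h) / m = -1 := by
          rw [Int.ediv_eq_iff_of_pos (by exact_mod_cast hm)]
          omega
        rw [this]; ring
      · rw [Int.ediv_eq_zero_of_lt (by omega) (by omega)]; ring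
    rw [hstep]
    push_cast
    have : ((t : ℤ) + 1) * h + c - h = t * h + c := by ring
    rw [this]
    ring

theorem leeAttains_consecutive_windows {n t : ℕ} {B : ℤ}
    (hB : (2 * n + 1) * B ≤ 2 * n * (n + 1) * t) : LeeAttains (2 * n + 1) (2 * t) B := by
  set m := 2 * n + 1 with hmdef
  -- Entries `2 * i` and `2 * i + 1` are `i * (n + 1)` and `(i + 1) * (n + 1)`, so the loss windows
  -- of successive pairs are adjacent and cover the cycle as evenly as possible.
  refine ⟨fun i => ((((i : ℕ) / 2 + (i : ℕ) % 2) * (n + 1) : ℕ) : ZMod m), fun x => ?_⟩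
  have hval : leeSum (fun i : Fin (2 * t) => ((((i : ℕ) / 2 + (i : ℕ) % 2) * (n + 1) : ℕ) : ZMod m)) x
      = ∑ i ∈ Finset.range t, (leeAbs (((i * (n + 1) : ℕ) : ZMod m) + x)
          + leeAbs ((((i + 1) * (n + 1) : ℕ) : ZMod m) + x)) := by
    rw [leeSum, Fin.sum_univ_eq_sum_range
      fun i => leeAbs ((((i / 2 + i % 2) * (n + 1) : ℕ) : ZMod m) + x)]
    clear hB
    induction t with
    | zero => simp
    | succ t ih =>
      rw [show 2 * (t + 1) = 2 * t + 1 + 1 by ring, Finset.sum_range_succ, Finset.sum_range_succ, ih,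
        Finset.sum_range_succ, add_assoc]
      have e1 : 2 * t / 2 + 2 * t % 2 = t := by omega
      have e2 : (2 * t + 1) / 2 + (2 * t + 1) % 2 = t + 1 := by omega
      rw [e1, e2]
  have hterm : ∀ i ∈ Finset.range t, ((leeAbs (((i * (n + 1) : ℕ) : ZMod m) + x)
          + leeAbs ((((i + 1) * (n + 1) : ℕ) : ZMod m) + x) : ℕ) : ℤ)
        = (n + 1) - (if (i * (n + 1) + x.val) % m < n + 1 then (1 : ℤ) else 0) := by
    intro i _
    have h := leeAbs_add_leeAbs_add_succ_half (((i * (n + 1) : ℕ) : ZMod m) + x)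
    have e1 : ((i * (n + 1) : ℕ) : ZMod m) + x = ((i * (n + 1) + x.val : ℕ) : ZMod m) := by
      push_cast; simp
    have e2 : (((i + 1) * (n + 1) : ℕ) : ZMod m) + x
        = ((i * (n + 1) : ℕ) : ZMod m) + x + ((n + 1 : ℕ) : ZMod m) := by
      push_cast; ring
    rw [e2]
    have e3 : (((i * (n + 1) : ℕ) : ZMod m) + x).val = (i * (n + 1) + x.val) % m := by
      rw [e1, ZMod.val_natCast]
    rw [e3] at h
    split_ifs at h ⊢ <;> omega
  rw [hval, Nat.cast_sum, Finset.sum_congr rfl hterm, Finset.sum_sub_distrib,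
    sum_window_indicator (by omega) (by omega)]
  have hm0 : (0 : ℤ) < m := by positivity
  have h1 := Int.emod_add_mul_ediv ((t : ℤ) * (n + 1 : ℕ) + x.val - (n + 1 : ℕ)) m
  have h2 := Int.emod_add_mul_ediv ((x.val : ℤ) - (n + 1 : ℕ)) m
  have h3 := Int.emod_nonneg ((t : ℤ) * (n + 1 : ℕ) + x.val - (n + 1 : ℕ)) hm0.ne'
  have h4 := Int.emod_lt_of_pos ((x.val : ℤ) - (n + 1 : ℕ)) hm0
  simp only [Finset.sum_const, Finset.card_range, nsmul_eq_mul]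
  generalize ((t : ℤ) * (n + 1 : ℕ) + x.val - (n + 1 : ℕ)) / m = a at *
  generalize ((x.val : ℤ) - (n + 1 : ℕ)) / m = b at *
  have hmn : (m : ℤ) = 2 * n + 1 := by rw [hmdef]; push_cast; ring
  rw [← Int.lt_add_one_iff]
  refine lt_of_mul_lt_mul_left ?_ hm0.le
  rw [← hmn] at hB
  refine hB.trans_lt ?_
  have e : (m : ℤ) * (t * (n + 1)) = 2 * n * (n + 1) * t + t * (n + 1) := by rw [hmn]; ring
  have : (m : ℤ) * (t * (n + 1) - (a - b) + 1)
    = 2 * n * (n + 1) * t + t * (n + 1) - m * a + m * b + m := by rw [← e]; ring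
  rw [this]
  push_cast at h1 h2 h3 h4
  linarith

/-! ### Reduction to the points `-v i`, and periodic sequences. -/

theorem le_leeSum_of_forall_le_leeSum_neg {m r : ℕ} [NeZero m] [NeZero r] {v : Fin r → ZMod m}
    {B : ℤ} (h : ∀ i, B ≤ leeSum v (-v i)) (x : ZMod m) : B ≤ leeSum v x := by
  obtain ⟨y, -, hy⟩ := Finset.exists_min_image Finset.univ (leeSum v) Finset.univ_nonempty
  replace hy : ∀ z, leeSum v y ≤ leeSum v z := fun z => hy z (Finset.mem_univ z)
  suffices hB : B ≤ leeSum v y from hB.trans (by exact_mod_cast hy x)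
  by_contra hlt
  -- A minimum below `B` avoids every `-v i`, so `leeSum v` is concave there and both neighbours are
  -- minimal too. The minimum value thus spreads around the whole cycle, reaching `-v 0`.
  have hstep : ∀ k : ℕ, leeSum v (y + k) = leeSum v y := by
    intro k
    induction k with
    | zero => simp
    | succ k ih =>
      have hne : ∀ i, v i + (y + k) ≠ 0 := by
        intro i hi
        have : y + k = -v i := by rw [eq_neg_iff_add_eq_zero, add_comm, hi]
        rw [this] at ih
        exact hlt (ih ▸ h i)
      have hsum : leeSum v (y + k + 1) + leeSum v (y + k - 1) ≤ 2 * leeSum v (y + k) := by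
        simp only [leeSum]
        rw [← Finset.sum_add_distrib, Finset.mul_sum]
        refine Finset.sum_le_sum fun i _ => ?_
        rw [← add_assoc (v i), ← add_sub_assoc (v i)]
        exact leeAbs_add_one_add_leeAbs_sub_one_le (hne i)
      have h1 := hy (y + k + 1)
      have h2 := hy (y + k - 1)
      rw [Nat.cast_succ, ← add_assoc]
      omega
  obtain ⟨k, -, hk⟩ := exists_natCast_eq (-v 0 - y)
  refine hlt ?_
  rw [← hstep k, hk]
  simpa using h 0

theorem sum_range_int_add_of_periodic {M : Type*} [AddCommGroup M] {f : ℤ → M} {r : ℕ}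
    (hf : Function.Periodic f r) (a : ℤ) :
    ∑ k ∈ Finset.range r, f (a + k) = ∑ k ∈ Finset.range r, f k := by
  have hstep : ∀ a : ℤ, ∑ k ∈ Finset.range r, f (a + 1 + k) = ∑ k ∈ Finset.range r, f (a + k) := by
    intro a
    have h1 := Finset.sum_range_succ (fun k : ℕ => f (a + k)) r
    rw [Finset.sum_range_succ'] at h1
    have h2 : f (a + r) = f (a + (0 : ℕ)) := by simpa using hf a
    rw [h2, add_right_cancel_iff] at h1
    rw [← h1]
    refine Finset.sum_congr rfl fun k _ => ?_
    congr 1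
    push_cast
    ring
  induction a using Int.induction_on with
  | zero => simp
  | succ n ih => rw [hstep, ih]
  | pred n ih => rw [← ih, ← hstep, sub_add_cancel]

theorem sum_range_int_centered {M : Type*} [AddCommGroup M] {f : ℤ → M} {s : ℕ}
    (hf : Function.Periodic f (2 * s + 1 : ℕ)) (j : ℤ) :
    ∑ k ∈ Finset.range (2 * s + 1), f k
      = f j + ∑ k ∈ Finset.range s, (f (j + (k + 1)) + f (j - (k + 1))) := by
  rw [← sum_range_int_add_of_periodic hf (j - s), show 2 * s + 1 = s + (s + 1) by ring,
    Finset.sum_range_add, Finset.sum_range_succ', Finset.sum_add_distrib,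
    ← Finset.sum_range_reflect (fun k : ℕ => f (j - (k + 1)))]
  have h1 : ∑ k ∈ Finset.range s, f (j - s + k)
      = ∑ k ∈ Finset.range s, f (j - ((s - 1 - k : ℕ) + 1)) := by
    refine Finset.sum_congr rfl fun k hk => ?_
    have := Finset.mem_range.1 hk
    congr 1
    omega
  have h2 : ∀ k : ℕ, j - s + (s + (k + 1) : ℕ) = j + (k + 1) := by
    intro k; push_cast; ring
  simp only [h1, h2]
  have h3 : j - (s : ℤ) + (s + 0 : ℕ) = j := by push_cast; ring
  rw [h3]
  abel

/-- The sum of the distances from the point `v j` to the other points of a periodic sequence. -/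
def distanceSum (v : ℤ → ℤ) (s : ℕ) (j : ℤ) : ℤ :=
  ∑ k ∈ Finset.range s, (v (j + (k + 1)) - v (j - (k + 1)))

/-- By `hhalf`, the `s` points on either side of `v j` are within half the circle, so their Lee
distances to `v j` are plain differences and `leeSum v (-v j)` is `distanceSum v s j`. -/
theorem leeAttains_of_periodic {m s : ℕ} [NeZero m] {v : ℤ → ℤ} {B : ℤ} (hmono : Monotone v)
    (hper : ∀ j, v (j + (2 * s + 1 : ℕ)) = v j + m) (hhalf : ∀ j, 2 * (v (j + s) - v j) ≤ m)
    (hB : ∀ j, B ≤ distanceSum v s j) : LeeAttains m (2 * s + 1) B := by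
  refine ⟨fun i => ((v (i : ℕ) : ℤ) : ZMod m), le_leeSum_of_forall_le_leeSum_neg fun i => ?_⟩
  generalize ((i : ℕ) : ℤ) = j
  refine (hB j).trans (le_of_eq ?_)
  have hf : Function.Periodic (fun k : ℤ => (leeAbs ((v k : ZMod m) - (v j : ZMod m)) : ℤ))
      (2 * s + 1 : ℕ) := by
    intro k
    simp only [hper k, Int.cast_add, Int.cast_natCast, ZMod.natCast_self, add_zero]
  rw [leeSum, Nat.cast_sum]
  simp only [← sub_eq_add_neg]
  rw [Fin.sum_univ_eq_sum_range
    fun k : ℕ => (leeAbs ((v (k : ℤ) : ZMod m) - (v j : ZMod m)) : ℤ),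
    sum_range_int_centered hf j, sub_self, leeAbs_zero, Nat.cast_zero, zero_add, distanceSum]
  refine Finset.sum_congr rfl fun k hk => ?_
  have hk := Finset.mem_range.1 hk
  have h1 : v j ≤ v (j + (k + 1)) := hmono (by omega)
  have h2 : v (j + (k + 1)) ≤ v (j + s) := hmono (by omega)
  have h3 : v (j - (k + 1)) ≤ v j := hmono (by omega)
  have h4 : v (j - s) ≤ v (j - (k + 1)) := hmono (by omega)
  have h5 := hhalf j
  have h6 := hhalf (j - s)
  rw [sub_add_cancel] at h6
  rw [← leeAbs_neg ((v (j - (k + 1)) : ZMod m) - (v j : ZMod m)), neg_sub, ← Int.cast_sub,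
    ← Int.cast_sub, leeAbs_intCast (by omega) (by omega), leeAbs_intCast (by omega) (by omega)]
  omega

/-- Both halves of the sum telescope, and periodicity turns `v (j - s)` into `v (j + (s + 1)) - m`.
-/
theorem distanceSum_succ_sub {v : ℤ → ℤ} {s m : ℕ}
    (hper : ∀ j, v (j + (2 * s + 1 : ℕ)) = v j + m) (j : ℤ) :
    distanceSum v s (j + 1) - distanceSum v s j = 2 * v (j + (s + 1)) - v j - v (j + 1) - m := by
  have h1 := Finset.sum_range_sub (fun k : ℕ => v (j + 1 + k)) s
  have h2 := Finset.sum_range_sub (fun k : ℕ => v (j - k)) s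
  have h3 : v (j + (s + 1)) = v (j - s) + m := by
    rw [← hper]; congr 1; push_cast; ring
  have h4 : distanceSum v s (j + 1) - distanceSum v s j
      = ∑ k ∈ Finset.range s, (v (j + 1 + (k + 1 : ℕ)) - v (j + 1 + k))
        + ∑ k ∈ Finset.range s, (v (j - (k + 1 : ℕ)) - v (j - k)) := by
    rw [distanceSum, distanceSum, ← Finset.sum_sub_distrib, ← Finset.sum_add_distrib]
    refine Finset.sum_congr rfl fun k _ => ?_
    have e1 : j + 1 + ((k : ℤ) + 1) = j + 1 + (k + 1 : ℕ) := by push_cast; ring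
    have e2 : j + 1 - ((k : ℤ) + 1) = j - k := by ring
    have e3 : j + ((k : ℤ) + 1) = j + 1 + k := by ring
    have e4 : j - ((k : ℤ) + 1) = j - (k + 1 : ℕ) := by push_cast; ring
    rw [e1, e2, e3, e4]
    ring
  rw [h4, h1, h2]
  simp only [Nat.cast_zero, add_zero, sub_zero]
  have h5 : j + 1 + (s : ℤ) = j + (s + 1) := by ring
  rw [h5]
  linarith

/-! ### Nearly equally spaced points for odd length at most `m`. -/

/-- A sequence whose steps, over each period of length `r`, are `r - q` times `d` followed by
`q` times `d + 1`. -/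
def blockSeq (d q r i : ℤ) : ℤ := d * i + q * (i / r) + max 0 (i % r - (r - q))

/-- The endpoint `b = r` is allowed so that a step may cross a period boundary. -/
theorem blockSeq_mul_add {d q r : ℤ} (hq : 0 ≤ q) (hqr : q ≤ r) (hr : 0 < r) (a : ℤ) {b : ℤ}
    (h0 : 0 ≤ b) (h1 : b ≤ r) :
    blockSeq d q r (r * a + b) = d * (r * a + b) + q * a + max 0 (b - (r - q)) := by
  rcases h1.lt_or_eq with h | rfl
  · rw [blockSeq, Int.mul_add_emod_self_left, Int.emod_eq_of_lt h0 h, add_comm (r * a) b,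
      Int.add_mul_ediv_left _ _ hr.ne', Int.ediv_eq_zero_of_lt h0 h, zero_add]
  · have h2 : b * a + b = b * (a + 1) := by ring
    rw [blockSeq, h2, Int.mul_emod_right, Int.mul_ediv_cancel_left _ hr.ne', max_eq_left, max_eq_right]
    · ring
    · omega
    · omega

theorem blockSeq_add_period {d q r : ℤ} (hr : 0 < r) (i : ℤ) :
    blockSeq d q r (i + r) = blockSeq d q r i + (d * r + q) := by
  rw [blockSeq, blockSeq, Int.add_emod_right, Int.add_ediv_of_dvd_right dvd_rfl,
    Int.ediv_self hr.ne']
  ring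

/-- The indicator of the long steps of `blockSeq`. -/
def blockStep (q r i : ℤ) : ℤ := if r - q ≤ i % r then 1 else 0

theorem blockSeq_succ {d q r : ℤ} (hq : 0 ≤ q) (hqr : q ≤ r) (hr : 0 < r) (i : ℤ) :
    blockSeq d q r (i + 1) = blockSeq d q r i + d + blockStep q r i := by
  have h0 := Int.emod_nonneg i hr.ne'
  have h1 := Int.emod_lt_of_pos i hr
  have h2 := Int.mul_ediv_add_emod i r
  have h3 := blockSeq_mul_add (d := d) hq hqr hr (i / r) h0 h1.le
  have h4 := blockSeq_mul_add (d := d) hq hqr hr (i / r) (b := i % r + 1) (by omega) (by omega)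
  rw [← add_assoc] at h4
  rw [h2] at h3 h4
  rw [h3, h4, blockStep]
  split_ifs with h
  · rw [max_eq_right (by omega), max_eq_right (by omega)]; ring
  · rw [max_eq_left (by omega), max_eq_left (by omega)]; ring

theorem sum_max_alternating {q : ℤ} (hq : 0 ≤ q) (s : ℕ) :
    ∑ k ∈ Finset.range s, (max 0 (q - 1 - 2 * k) - max 0 (q - 2 - 2 * k)) = min (s : ℤ) (q / 2) := by
  induction s with
  | zero => simp; omega
  | succ s ih => rw [Finset.sum_range_succ, ih]; push_cast; omega

theorem sum_two_mul_succ (s : ℕ) (δ : ℤ) :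
    ∑ k ∈ Finset.range s, 2 * ((k : ℤ) + 1) * δ = s * (s + 1) * δ := by
  induction s with
  | zero => simp
  | succ s ih => rw [Finset.sum_range_succ, ih]; push_cast; ring

theorem leeAttains_of_odd {m s : ℕ} {B : ℤ} (hm : 2 * s + 1 ≤ m)
    (hB : (2 * s + 1) * B ≤ m * s * (s + 1)) : LeeAttains m (2 * s + 1) B := by
  have : NeZero m := ⟨by omega⟩
  obtain ⟨r, hr⟩ : ∃ r : ℤ, r = 2 * s + 1 := ⟨_, rfl⟩
  have hrpos : 0 < r := by omega
  obtain ⟨d, hd⟩ : ∃ d : ℤ, d = m * (s + 1) / r := ⟨_, rfl⟩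
  obtain ⟨q, hqdef⟩ : ∃ q : ℤ, q = m * (s + 1) % r := ⟨_, rfl⟩
  have hdq : (m : ℤ) * (s + 1) = d * r + q := by
    rw [hd, hqdef, mul_comm _ r, Int.mul_ediv_add_emod]
  have hq0 : 0 ≤ q := hqdef ▸ Int.emod_nonneg _ hrpos.ne'
  have hqr : q < r := hqdef ▸ Int.emod_lt_of_pos _ hrpos
  -- This is where `r ≤ m` enters: otherwise `m + r ≤ 2 * q < 2 * r`.
  have hdm : (m : ℤ) ≤ 2 * d := by
    by_contra hlt
    have h1 : 2 * d + 1 ≤ m := by omega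
    have h2 : r * (2 * d + 1) ≤ r * m := mul_le_mul_of_nonneg_left h1 hrpos.le
    have h3 : 2 * ((m : ℤ) * (s + 1)) = r * m + m := by rw [hr]; ring
    have h4 : r ≤ m := by rw [hr]; exact_mod_cast hm
    nlinarith
  obtain ⟨W, hW⟩ : ∃ W : ℤ → ℤ, W = blockSeq d q r := ⟨_, rfl⟩
  have hWper : ∀ i, W (i + r) = W i + (d * r + q) := by
    rw [hW]; exact blockSeq_add_period hrpos
  have hWsucc : ∀ i, W (i + 1) = W i + d + blockStep q r i := by
    rw [hW]; exact blockSeq_succ hq0 hqr.le hrpos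
  have hstep0 : ∀ i, 0 ≤ blockStep q r i := by
    intro i; unfold blockStep; split_ifs <;> norm_num
  -- Since `2 * (s + 1) = r + 1`, `W i` is `v (i * (s + 1))`: the steps `d`, `d + 1` of `W` are the
  -- jumps of `v` by `s + 1` places, just over half the circle. On average `v j` grows by `m / r`.
  obtain ⟨v, hv⟩ : ∃ v : ℤ → ℤ, ∀ j, v j = W (2 * j) - j * m := ⟨_, fun _ => rfl⟩
  have hper : ∀ j, v (j + (2 * s + 1 : ℕ)) = v j + m := by
    intro j
    have e : 2 * (j + (2 * s + 1 : ℕ)) = 2 * j + r + r := by rw [hr]; push_cast; ring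
    rw [hv, hv, e, hWper, hWper, ← hdq]
    push_cast
    ring
  have hmono : Monotone v := by
    refine monotone_int_of_le_succ fun j => ?_
    have e : 2 * (j + 1) = 2 * j + 1 + 1 := by ring
    rw [hv, hv, e, hWsucc, hWsucc]
    linarith [hstep0 (2 * j), hstep0 (2 * j + 1)]
  have hhalf : ∀ j, 2 * (v (j + s) - v j) ≤ m := by
    intro j
    have e : 2 * (j + s) = 2 * j - 1 + r := by rw [hr]; ring
    have h1 := hWsucc (2 * j - 1)
    rw [sub_add_cancel] at h1
    rw [hv, hv, e, hWper, h1, ← hdq]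
    linarith [hstep0 (2 * j - 1)]
  have hdiff : ∀ j, distanceSum v s (j + 1) - distanceSum v s j
      = blockStep q r (2 * j) - blockStep q r (2 * j + 1) := by
    intro j
    have e1 : 2 * (j + (s + 1)) = 2 * j + 1 + r := by rw [hr]; ring
    have e2 : 2 * (j + 1) = 2 * j + 1 + 1 := by ring
    rw [distanceSum_succ_sub hper, hv, hv, hv, e1, e2, hWper, hWsucc (2 * j + 1),
      hWsucc (2 * j), ← hdq]
    ring
  have hzero : distanceSum v s 0 = s * (s + 1) * (2 * d - m) + s * q + q / 2 := by
    have hterm : ∀ k ∈ Finset.range s, v (0 + (k + 1)) - v (0 - (k + 1))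
        = 2 * ((k : ℤ) + 1) * (2 * d - m) + q
          + max 0 (q - 1 - 2 * (s - 1 - k : ℕ)) - max 0 (q - 2 - 2 * k) := by
      intro k hk
      have hk := Finset.mem_range.1 hk
      have h1 := blockSeq_mul_add (d := d) hq0 hqr.le hrpos 0 (b := 2 * (k + 1)) (by omega) (by omega)
      have h2 := blockSeq_mul_add (d := d) hq0 hqr.le hrpos (-1) (b := r - 2 * (k + 1))
        (by omega) (by omega)
      have e1 : (2 : ℤ) * (0 + (k + 1)) = r * 0 + 2 * (k + 1) := by ring
      have e2 : (2 : ℤ) * (0 - (k + 1)) = r * (-1) + (r - 2 * (k + 1)) := by ring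
      have e3 : q - 1 - 2 * ((s - 1 - k : ℕ) : ℤ) = 2 * (k + 1) - (r - q) := by omega
      have e4 : q - 2 - 2 * (k : ℤ) = r - 2 * (k + 1) - (r - q) := by ring
      rw [hv, hv, hW, e1, e2, h1, h2, e3, e4]
      ring
    have hrefl := Finset.sum_range_reflect (fun k : ℕ => max 0 (q - 1 - 2 * (k : ℤ))) s
    have halt := sum_max_alternating hq0 s
    rw [Finset.sum_sub_distrib] at halt
    rw [distanceSum, Finset.sum_congr rfl hterm, Finset.sum_sub_distrib, Finset.sum_add_distrib,
      Finset.sum_add_distrib, sum_two_mul_succ, hrefl]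
    simp only [Finset.sum_const, Finset.card_range, nsmul_eq_mul]
    have : min (s : ℤ) (q / 2) = q / 2 := by omega
    linarith
  -- The long steps form one block per period, so by `hdiff` the value changes only where a pair of
  -- positions straddles the start of that block. Going backwards from 0 this can only raise it.
  have hneg : ∀ j : ℕ, j ≤ s → distanceSum v s 0 ≤ distanceSum v s (-j) := by
    intro j
    induction j with
    | zero => simp
    | succ j ih =>
      intro hj
      refine (ih (by omega)).trans ?_
      have h := hdiff (-(j + 1 : ℕ))
      have e1 : -((j + 1 : ℕ) : ℤ) + 1 = -j := by push_cast; ring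
      have e2 : (2 * -((j + 1 : ℕ) : ℤ)) % r = r - 2 * (j + 1) := by
        rw [← Int.add_emod_right, Int.emod_eq_of_lt (by omega) (by omega)]
        push_cast; ring
      have e3 : (2 * -((j + 1 : ℕ) : ℤ) + 1) % r = r - 2 * (j + 1) + 1 := by
        rw [← Int.add_emod_right, Int.emod_eq_of_lt (by omega) (by omega)]
        push_cast; ring
      rw [e1, blockStep, blockStep, e2, e3] at h
      split_ifs at h <;> omega
  -- Going forwards, the pair `2 * j`, `2 * j + 1` straddles the block start `r - q` only if `r - q`
  -- is odd, that is `q` even; then the value drops by 1, once.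
  have hpos : ∀ j : ℕ, j ≤ s → distanceSum v s 0
      - (if q % 2 = 0 ∧ r - q < 2 * j then 1 else 0) ≤ distanceSum v s j := by
    intro j
    induction j with
    | zero => intro _; split_ifs <;> simp
    | succ j ih =>
      intro hj
      have hi := ih (by omega)
      have h := hdiff j
      have e2 : (2 * (j : ℤ)) % r = 2 * j := Int.emod_eq_of_lt (by omega) (by omega)
      have e3 : (2 * (j : ℤ) + 1) % r = 2 * j + 1 := Int.emod_eq_of_lt (by omega) (by omega)
      rw [blockStep, blockStep, e2, e3] at h
      push_cast
      split_ifs at h hi ⊢ <;> omega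
  have hall : ∀ j, distanceSum v s 0 - (if q % 2 = 0 ∧ 0 < q then 1 else 0)
      ≤ distanceSum v s j := by
    intro j
    have hvper : ∀ a j : ℤ, v (j + a * r) = v j + a * m := by
      intro a
      -- Removing the linear drift makes the sequence periodic, which yields the shift by any
      -- multiple of `r`.
      have hc : Function.Periodic (fun j => v j * r - j * m) r := by
        intro j
        have e := hper j
        rw [show ((2 * s + 1 : ℕ) : ℤ) = r by rw [hr]; push_cast; ring] at e
        simp only [e]
        ring
      intro j
      have h := hc.int_mul a j
      simp only [Int.cast_id] at h
      exact mul_right_cancel₀ hrpos.ne' (by linarith)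
    have hE : ∀ a j : ℤ, distanceSum v s (j + a * r) = distanceSum v s j := by
      intro a j
      refine Finset.sum_congr rfl fun k _ => ?_
      rw [add_right_comm, add_sub_right_comm, hvper, hvper]
      ring
    have h0 := Int.emod_nonneg (j + s) hrpos.ne'
    have h1 := Int.emod_lt_of_pos (j + s) hrpos
    have h2 := Int.emod_add_mul_ediv (j + s) r
    -- The representative of `j` modulo `r` in `[-s, s]`, the range covered by `hneg` and `hpos`.
    obtain ⟨b, hb⟩ : ∃ b : ℤ, b = (j + s) % r - s := ⟨_, rfl⟩
    have h3 : j = b + (j + s) / r * r := by rw [mul_comm]; omega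
    rw [h3, hE]
    rcases le_total 0 b with hb0 | hb0
    · lift b to ℕ using hb0
      have := hpos b (by omega)
      split_ifs at this ⊢ <;> omega
    · obtain ⟨c, hc⟩ := Int.eq_ofNat_of_zero_le (neg_nonneg.2 hb0)
      have := hneg c (by omega)
      rw [← hc, neg_neg] at this
      split_ifs <;> omega
  refine leeAttains_of_periodic hmono hper hhalf fun j => le_trans ?_ (hall j)
  rw [hzero, ← Int.lt_add_one_iff]
  refine lt_of_mul_lt_mul_left ?_ hrpos.le
  rw [← hr] at hB
  refine hB.trans_lt ?_
  have h1 : r * (2 * d - m) = m - 2 * q := by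
    have : 2 * ((m : ℤ) * (s + 1)) = r * m + m := by rw [hr]; ring
    linarith
  have h2 : r * (s * (s + 1) * (2 * d - m) + s * q) = m * s * (s + 1) - s * q := by
    have : r * (s * (s + 1) * (2 * d - m) + s * q)
      = s * (s + 1) * (r * (2 * d - m)) + r * (s * q) := by ring
    rw [this, h1, hr]
    ring
  -- The rounding loss, including the possible drop by 1, stays below one unit; integrality of `B`
  -- then closes the gap.
  have h3 : s * q < r * (q / 2 - (if q % 2 = 0 ∧ 0 < q then 1 else 0) + 1) := by
    obtain ⟨p, hp⟩ : ∃ p, p = q / 2 := ⟨_, rfl⟩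
    rw [← hp]
    rcases Int.emod_two_eq_zero_or_one q with he | ho
    · have hq2 : q = 2 * p := by omega
      split_ifs with hif
      · rw [hr, hq2]; nlinarith
      · have hq' : q = 0 := by omega
        have hp' : p = 0 := by omega
        rw [hq', hp']
        linarith
    · have hq2 : q = 2 * p + 1 := by omega
      rw [if_neg (by omega), hr, hq2]
      nlinarith
  linarith

/-! ### Assembling the cases. -/

theorem floor_mul_le {a b c : ℚ} (ha : a * c = b) (hc : 0 ≤ c) : (⌊a⌋ : ℚ) * c ≤ b := by
  rw [← ha]
  exact mul_le_mul_of_nonneg_right (Int.floor_le a) hc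

theorem leeAttains_of_odd_of_even {m r : ℕ} {B : ℤ} (hm : Odd m) (hr : Even r)
    (hB : 4 * m * B ≤ r * (m ^ 2 - 1)) : LeeAttains m r B := by
  obtain ⟨n, rfl⟩ := hm
  obtain ⟨t, rfl⟩ := hr
  rw [← two_mul]
  refine leeAttains_consecutive_windows ?_
  push_cast at hB
  nlinarith

theorem leeAttains_of_odd_of_odd_of_lt {m r : ℕ} {B : ℤ} (hm : Odd m) (hr : Odd r) (hlt : m < r)
    (hB : 4 * m * B ≤ r * (m ^ 2 - 1)) : LeeAttains m r B := by
  obtain ⟨t, rfl⟩ := Nat.exists_eq_add_of_lt hlt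
  obtain ⟨n, hn⟩ := hm
  have ht : Even (t + 1) := by
    rw [Nat.even_iff]
    have := Nat.odd_iff.1 hr
    omega
  have h := leeAttains_of_odd_of_even (B := B - n * (n + 1)) ⟨n, hn⟩ ht (by
    subst hn
    push_cast at hB ⊢
    nlinarith)
  have h2 := leeAttains_univ n
  rw [← hn] at h2
  have h3 := h2.append h
  rw [add_sub_cancel] at h3
  exact h3

theorem leeAttains_of_odd_of_le {m r : ℕ} {B : ℤ} (hr : Odd r) (hle : r ≤ m)
    (hB : 4 * r * B ≤ m * (r ^ 2 - 1)) : LeeAttains m r B := by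
  obtain ⟨s, rfl⟩ := hr
  refine leeAttains_of_odd hle ?_
  push_cast at hB
  linarith

theorem leeAttains_of_even_of_odd_of_lt {m r : ℕ} {B : ℤ} (hm0 : 0 < m) (hm : Even m) (hr : Odd r)
    (hlt : m < r) (hB : 4 * B + 2 ≤ m * r) : LeeAttains m r B := by
  obtain ⟨n, rfl⟩ := hm.exists_two_nsmul
  obtain ⟨s, rfl⟩ := hr
  rw [smul_eq_mul] at *
  obtain ⟨k, rfl⟩ : ∃ k, n = k + 1 := ⟨n - 1, by omega⟩
  obtain ⟨t, rfl⟩ : ∃ t, s = k + t := ⟨s - k, by omega⟩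
  -- A spaced block of length `m - 1`, the largest odd length available, already meets the bound
  -- with loss 1/2; the antipodal pairs filling up the rest lose nothing.
  have h := leeAttains_of_odd_of_le (m := 2 * (k + 1)) (r := 2 * k + 1)
    (B := B - t * (k + 1)) ⟨k, rfl⟩ (by omega) (by
      push_cast at hB ⊢
      have h1 : 4 * (B - t * (k + 1)) + 2 ≤ 2 * ((k : ℤ) + 1) * (2 * k + 1) := by linarith
      have h2 := mul_le_mul_of_nonneg_left h1 (by positivity : (0 : ℤ) ≤ 2 * k + 1)
      have h3 : (0 : ℤ) ≤ k := by positivity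
      linarith)
  have h3 := h.append (leeAttains_antipodal_pairs (n := k + 1) (by omega) t)
  push_cast at h3
  rw [sub_add_cancel, show 2 * k + 1 + 2 * t = 2 * (k + t) + 1 by ring] at h3
  exact h3

theorem exists_hBound_le_leeSum {m r : ℕ} (hm : 0 < m) (hr : 0 < r) :
    ∃ v : Fin r → ZMod m, ∀ x, hBound m r ≤ leeSum v x := by
  have hmq : (m : ℚ) ≠ 0 := by exact_mod_cast hm.ne'
  have hrq : (r : ℚ) ≠ 0 := by exact_mod_cast hr.ne'
  have key : ∀ B : ℤ, LeeAttains m r B →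
      ∃ v : Fin r → ZMod m, ∀ x, ((B : ℤ) : ℚ) ≤ leeSum v x := by
    rintro B ⟨v, hv⟩
    exact ⟨v, fun x => by exact_mod_cast hv x⟩
  unfold hBound
  split_ifs with h1 h2 h3 h4
  · obtain ⟨n, rfl⟩ := h1.1.exists_two_nsmul
    obtain ⟨t, rfl⟩ := h1.2.exists_two_nsmul
    rw [smul_eq_mul] at *
    rw [smul_eq_mul] at *
    obtain ⟨v, hv⟩ := key _ (leeAttains_antipodal_pairs (by omega) t)
    refine ⟨v, fun x => le_trans (le_of_eq ?_) (hv x)⟩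
    push_cast
    ring
  · refine key _ (leeAttains_of_even_of_odd_of_lt hm h2.1 h2.2.1 h2.2.2 ?_)
    have h := Int.floor_le ((m * r : ℚ) / 4 - 1 / 2)
    have h' : ((4 * ⌊(m * r : ℚ) / 4 - 1 / 2⌋ + 2 : ℤ) : ℚ) ≤ (m * r : ℤ) := by
      push_cast; linarith
    exact_mod_cast h'
  · have h := floor_mul_le (a := (m * r : ℚ) / 4 - r / (4 * m)) (b := r * (m ^ 2 - 1))
      (c := 4 * m) (by field_simp) (by positivity)
    have h' : ((4 * m * ⌊(m * r : ℚ) / 4 - r / (4 * m)⌋ : ℤ) : ℚ) ≤ (r * (m ^ 2 - 1) : ℤ) := by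
      push_cast; linarith
    have h'' := (Int.cast_le (R := ℚ)).1 h'
    rcases Nat.even_or_odd r with hr' | hr'
    · exact key _ (leeAttains_of_odd_of_even h3.1 hr' h'')
    · exact key _ (leeAttains_of_odd_of_odd_of_lt h3.1 hr' h3.2 h'')
  · refine key _ (leeAttains_of_odd_of_even h4.1 h4.2.1 ?_)
    have h := Int.floor_le ((m * r : ℚ) / 4 - 1 / 2)
    have h' : ((4 * ⌊(m * r : ℚ) / 4 - 1 / 2⌋ + 2 : ℤ) : ℚ) ≤ (m * r : ℤ) := by
      push_cast; linarith
    have h'' := (Int.cast_le (R := ℚ)).1 h'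
    have h5 : (r : ℤ) < m := by exact_mod_cast h4.2.2
    have h6 : (1 : ℤ) ≤ m := by exact_mod_cast hm
    nlinarith
  · have hodd : Odd r := by
      rw [← Nat.not_even_iff_odd]
      intro he
      rcases Nat.even_or_odd m with h | h
      · exact h1 ⟨h, he⟩
      · refine h4 ⟨h, he, lt_of_le_of_ne (not_lt.1 fun h' => h3 ⟨h, h'⟩) ?_⟩
        rintro rfl
        exact Nat.not_even_iff_odd.2 h he
    have hle : r ≤ m := by
      rw [← not_lt]
      intro hlt
      rcases Nat.even_or_odd m with h | h
      · exact h2 ⟨h, hodd, hlt⟩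
      · exact h3 ⟨h, hlt⟩
    refine key _ (leeAttains_of_odd_of_le hodd hle ?_)
    have h := floor_mul_le (a := (m * r : ℚ) / 4 - m / (4 * r)) (b := m * (r ^ 2 - 1))
      (c := 4 * r) (by field_simp) (by positivity)
    have h' : ((4 * r * ⌊(m * r : ℚ) / 4 - m / (4 * r)⌋ : ℤ) : ℚ) ≤ (m * (r ^ 2 - 1) : ℤ) := by
      push_cast; linarith
    exact (Int.cast_le (R := ℚ)).1 h'

theorem theorem3 (m r : ℕ) (hm : 0 < m) (hr : 0 < r) :
    IsGreatest {N : ℚ | ∃ v : Fin r → ZMod m, LeeAdmissible v ∧ (leeNorm v : ℚ) = N}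
      (hBound m r) ∧
    (2 < m → IsLeeCoveringRadius (repetitionCode m r : Set (Fin r → ZMod m)) (hBound m r)) := by
  have : NeZero m := ⟨hm.ne'⟩
  obtain ⟨v, hv⟩ := exists_hBound_le_leeSum hm hr
  have hle : ∀ w : Fin r → ZMod m, LeeAdmissible w → (leeNorm w : ℚ) ≤ hBound m r := by
    intro w hw
    obtain ⟨x, hx⟩ := exists_leeSum_le_hBound hm hr w
    have h := hw x
    rw [leeNorm_add_smul_allOne] at h
    exact le_trans (by exact_mod_cast h) hx
  refine ⟨⟨?_, ?_⟩, fun _ => ⟨?_, ?_⟩⟩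
  · obtain ⟨y, -, hy⟩ := Finset.exists_min_image Finset.univ (leeSum v) Finset.univ_nonempty
    have hadm : LeeAdmissible (v + y • allOne m r) := by
      intro x
      rw [add_assoc, ← add_smul, leeNorm_add_smul_allOne, leeNorm_add_smul_allOne]
      exact hy _ (Finset.mem_univ _)
    refine ⟨_, hadm, le_antisymm (hle _ hadm) ?_⟩
    rw [leeNorm_add_smul_allOne]
    exact hv y
  · rintro _ ⟨w, hw, rfl⟩
    exact hle w hw
  · intro w
    obtain ⟨x, hx⟩ := exists_leeSum_le_hBound hm hr w
    refine ⟨(-x) • allOne m r, Submodule.mem_span_singleton.2 ⟨_, rfl⟩, ?_⟩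
    rwa [leeDistance_smul_allOne, neg_neg]
  · intro ρ hρ
    obtain ⟨c, hc, h⟩ := hρ v
    obtain ⟨x, rfl⟩ := Submodule.mem_span_singleton.1 hc
    rw [leeDistance_smul_allOne] at h
    exact (hv _).trans h
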